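/- Let $\Gamma$ be a countably infinite connected (simple) graph with symmetric edge weights $\mu_{x,y}=\mu_{y,x}>0$ for $x\sim y$ (and $\mu_{x,y}=0$ otherwise) such that $\mu(x)=\sum_{y\sim x}\mu_{x,y}<\infty$ for every vertex $x$. Put $\mu(A)=\sum_{y\in A}\mu(y)$, let $d$ be the graph distance, $B(x,R)=\{y: d(x,y)<R\}$ for real $R>0$, $V(x,R)=\mu(B(x,R))$ and $v(x,r,R)=V(x,R)-V(x,r)$. Let $(X_n)$ be the random walk with transition probabilities $P(x,y)=\mu_{x,y}/\mu(x)$, let $T_A=\min\{k: X_k\notin A\}$, $E_z(A)=\mathbb E(T_A\mid X_0=z)$, $E(x,R)=E_x(B(x,R))$ and $\overline E(x,R)=\max_{z\in B(x,R)}E_z(B(x,R))$. Let $\Delta=P-I$, and let $\lambda(x,R)$ be the smallest eigenvalue of $-\Delta$ with Dirichlet boundary conditions on $B(x,R)$, i.e. the smallest $\lambda$ for which there is $f\neq 0$ vanishing outside $B(x,R)$ with $-\Delta f=\lambda f$ on $B(x,R)$. With $(f,g)_\mu=\sum_x f(x)g(x)\mu(x)$ let $$\rho(x,r,R)=\Bigl(\inf\bigl\{(-\Delta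 f,f)_\mu : f \text{ finitely supported},\ f=1 \text{ on } B(x,r),\ f=0 \text{ on } \Gamma\setminus B(x,R)\bigr\}\Bigr)^{-1}.$$ Assume: * $(p_0)$: there is $p_0>0$ with $\mu_{x,y}/\mu(x)\ge p_0$ whenever $x\sim y$; * $(VD)$: there is $D_V>0$ with $V(x,2R)\le D_V V(x,R)$ for all $x\in\Gamma$, $R>0$; * $(TC)$: there is $C_T>1$ with $E(x,2R)\le C_T\,E(y,R)$ for all $x\in\Gamma$, $R>0$, $y\in B(x,R)$. Write $a\simeq b$ for $C^{-1}a\le b\le Ca$. Then there is a constant $C>1$ such that for all $x\in\Gamma$ and all real $R>0$ $$\lambda^{-1}(x,2R)\simeq E(x,2R)\simeq\overline E(x,2R),$$ and, for all $x\in\Gamma$ and all real $R>\tfrac12$, moreover $$\overline E(x,2R)\simeq\rho(x,R,2R)\,v(x,R,2R)\qquad\text{and}\qquad E(x,2R)\simeq\rho(x,R,2R)\,v(x,R,2R)$$ (the last relation being the Einstein relation). -/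

import Mathlib

open MeasureTheory ProbabilityTheory
open scoped ENNReal NNReal

/-- A connected graph on the vertex set `V` with symmetric edge weights `μ_{x,y} > 0`, of finite
total weight at each vertex.  The weight function is extended by `0` to non-adjacent pairs. -/
structure WeightedGraph (V : Type*) where
  graph : SimpleGraph V
  connected : graph.Connected
  weight : V → V → ℝ
  weight_symm : ∀ x y, weight x y = weight y x
  weight_pos : ∀ x y, graph.Adj x y → 0 < weight x y
  weight_zero : ∀ x y, ¬ graph.Adj x y → weight x y = 0
  weight_summable : ∀ x, Summable (weight x)

namespace WeightedGraph

noncomputable section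

variable {V : Type*}

/-- `μ(x) = ∑_{y ∼ x} μ_{x,y}`. -/
def vertexMeasure (Γ : WeightedGraph V) (x : V) : ℝ := ∑' y, Γ.weight x y

/-- `μ(A) = ∑_{y ∈ A} μ(y)`. -/
def setMeasure (Γ : WeightedGraph V) (A : Set V) : ℝ≥0∞ :=
  ∑' y : A, ENNReal.ofReal (Γ.vertexMeasure y)

/-- The transition probabilities `P(x,y) = μ_{x,y} / μ(x)`. -/
def transition (Γ : WeightedGraph V) (x y : V) : ℝ := Γ.weight x y / Γ.vertexMeasure x

/-- The open ball `B(x,R)` of the graph distance. -/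
def ball (Γ : WeightedGraph V) (x : V) (R : ℝ) : Set V := {y | (Γ.graph.dist x y : ℝ) < R}

/-- `V(x,R) = μ(B(x,R))`. -/
def volume (Γ : WeightedGraph V) (x : V) (R : ℝ) : ℝ≥0∞ := Γ.setMeasure (Γ.ball x R)

/-- `v(x,r,R) = V(x,R) - V(x,r)`. -/
def annulusVolume (Γ : WeightedGraph V) (x : V) (r R : ℝ) : ℝ≥0∞ :=
  Γ.volume x R - Γ.volume x r

/-! ### The random walk -/

lemma weight_nonneg (Γ : WeightedGraph V) (x y : V) : 0 ≤ Γ.weight x y := by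
  by_cases h : Γ.graph.Adj x y
  · exact (Γ.weight_pos x y h).le
  · exact (Γ.weight_zero x y h).ge

lemma vertexMeasure_pos [Infinite V] (Γ : WeightedGraph V) (x : V) : 0 < Γ.vertexMeasure x := by
  obtain ⟨y, hy⟩ := Γ.connected.preconnected.exists_adj_of_nontrivial x
  exact (Γ.weight_summable x).tsum_pos (Γ.weight_nonneg x) y (Γ.weight_pos x y hy)

lemma transition_nonneg (Γ : WeightedGraph V) (x y : V) : 0 ≤ Γ.transition x y :=
  div_nonneg (Γ.weight_nonneg x y) (tsum_nonneg (Γ.weight_nonneg x))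

lemma hasSum_transition [Infinite V] (Γ : WeightedGraph V) (x : V) :
    HasSum (Γ.transition x) 1 := by
  have h := (Γ.weight_summable x).hasSum.div_const (Γ.vertexMeasure x)
  have h1 : (∑' y, Γ.weight x y) / Γ.vertexMeasure x = 1 := div_self (Γ.vertexMeasure_pos x).ne'
  rwa [h1] at h

/-- The distribution `P(x,·)` of one step of the walk from `x`. -/
def stepPMF [Infinite V] (Γ : WeightedGraph V) (x : V) : PMF V :=
  ⟨fun y => ENNReal.ofReal (Γ.transition x y), by
    have h := Γ.hasSum_transition x
    rw [ENNReal.summable.hasSum_iff,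
      ← ENNReal.ofReal_tsum_of_nonneg (Γ.transition_nonneg x) h.summable, h.tsum_eq,
      ENNReal.ofReal_one]⟩

variable [MeasurableSpace V] [DiscreteMeasurableSpace V]

/-- The transition kernel of the walk. -/
def stepKernel [Infinite V] (Γ : WeightedGraph V) : Kernel V V :=
  ⟨fun x => (Γ.stepPMF x).toMeasure, Measurable.of_discrete⟩

instance [Infinite V] (Γ : WeightedGraph V) : IsMarkovKernel Γ.stepKernel :=
  ⟨fun x => inferInstanceAs (IsProbabilityMeasure (Γ.stepPMF x).toMeasure)⟩

/-- The conditional distribution of `X_{n+1}` given `(X_0, …, X_n)`: it is `P(X_n,·)`. -/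
def historyKernel [Infinite V] (Γ : WeightedGraph V) (n : ℕ) :
    Kernel ((_ : Finset.Iic n) → V) V :=
  Γ.stepKernel.comap (fun h => h ⟨n, Finset.mem_Iic.2 le_rfl⟩) (measurable_pi_apply _)

instance [Infinite V] (Γ : WeightedGraph V) (n : ℕ) : IsMarkovKernel (Γ.historyKernel n) := by
  unfold historyKernel; infer_instance

/-- The law on trajectories `ω = (X_0, X_1, …)` of the random walk started at `z`. -/
def walkLaw [Infinite V] (Γ : WeightedGraph V) (z : V) : Measure (ℕ → V) :=
  Kernel.traj (X := fun _ => V) Γ.historyKernel 0 (fun _ => z)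

/-- The exit time `T_A = min {k : X_k ∉ A}` (infinite if the trajectory stays in `A`). -/
def exitTime {V : Type*} (A : Set V) (ω : ℕ → V) : ℝ≥0∞ := ⨅ (k : ℕ) (_ : ω k ∉ A), (k : ℝ≥0∞)

/-- `E_z(A)`, the mean exit time from `A` of the walk started at `z`. -/
def meanExitFrom [Infinite V] (Γ : WeightedGraph V) (z : V) (A : Set V) : ℝ≥0∞ :=
  ∫⁻ ω, exitTime A ω ∂(Γ.walkLaw z)

/-- `E(x,R) = E_x(B(x,R))`. -/
def meanExit [Infinite V] (Γ : WeightedGraph V) (x : V) (R : ℝ) : ℝ≥0∞ :=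
  Γ.meanExitFrom x (Γ.ball x R)

/-- `Ē(x,R) = max_{z ∈ B(x,R)} E_z(B(x,R))`. -/
def maxMeanExit [Infinite V] (Γ : WeightedGraph V) (x : V) (R : ℝ) : ℝ≥0∞ :=
  ⨆ z ∈ Γ.ball x R, Γ.meanExitFrom z (Γ.ball x R)

end

noncomputable section

variable {V : Type*}

/-! ### The Laplace operator, the bottom Dirichlet eigenvalue and the resistance -/

/-- `Δ f = P f - f`. -/
def laplacian (Γ : WeightedGraph V) (f : V → ℝ) (x : V) : ℝ :=
  (∑' y, Γ.transition x y * f y) - f x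

/-- The eigenvalues of `-Δ^A`, the operator `-Δ` with Dirichlet boundary conditions on `A`, acting
on the functions which vanish outside `A`. -/
def dirichletEigenvalues (Γ : WeightedGraph V) (A : Set V) : Set ℝ :=
  {l | ∃ f : V → ℝ, f ≠ 0 ∧ (∀ x ∉ A, f x = 0) ∧ ∀ x ∈ A, -Γ.laplacian f x = l * f x}

/-- `λ(A)`, the smallest eigenvalue of `-Δ^A` (for finite nonempty `A` the infimum is attained). -/
def bottomEigenvalue (Γ : WeightedGraph V) (A : Set V) : ℝ := sInf (Γ.dirichletEigenvalues A)

/-- `(f, g)_μ = ∑_x f(x) g(x) μ(x)`. -/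
def innerProduct (Γ : WeightedGraph V) (f g : V → ℝ) : ℝ :=
  ∑' x, f x * g x * Γ.vertexMeasure x

/-- The resistance `ρ(A,B) = (inf {(-Δ f, f)_μ : f|_A = 1, f|_B = 0})⁻¹`, where `f` runs through
the finitely supported functions. -/
def resistance (Γ : WeightedGraph V) (A B : Set V) : ℝ≥0∞ :=
  (⨅ (f : V → ℝ) (_ : f.support.Finite ∧ (∀ x ∈ A, f x = 1) ∧ ∀ x ∈ B, f x = 0),
    ENNReal.ofReal (Γ.innerProduct (fun x => -Γ.laplacian f x) f))⁻¹

/-- `ρ(x,r,R) = ρ(B(x,r), Γ \ B(x,R))`. -/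
def annulusResistance (Γ : WeightedGraph V) (x : V) (r R : ℝ) : ℝ≥0∞ :=
  Γ.resistance (Γ.ball x r) (Γ.ball x R)ᶜ

/-- `λ⁻¹(x,R)`, where `λ(x,R) = λ(B(x,R))`. -/
def invBottomEigenvalue (Γ : WeightedGraph V) (x : V) (R : ℝ) : ℝ≥0∞ :=
  (ENNReal.ofReal (Γ.bottomEigenvalue (Γ.ball x R)))⁻¹

/-! ### The conditions -/

/-- Condition `(p₀)`. -/
def ControlledWeights (Γ : WeightedGraph V) : Prop :=
  ∃ p₀ : ℝ, 0 < p₀ ∧ ∀ x y, Γ.graph.Adj x y → p₀ ≤ Γ.weight x y / Γ.vertexMeasure x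

/-- Volume doubling `(VD)`. -/
def VolumeDoubling (Γ : WeightedGraph V) : Prop :=
  ∃ D : ℝ≥0, 0 < D ∧ ∀ (x : V) (R : ℝ), 0 < R → Γ.volume x (2 * R) ≤ D * Γ.volume x R

/-- The time comparison principle `(TC)`. -/
def TimeComparison [MeasurableSpace V] [DiscreteMeasurableSpace V] [Infinite V]
    (Γ : WeightedGraph V) : Prop :=
  ∃ C : ℝ≥0, 1 < C ∧ ∀ (x : V) (R : ℝ), 0 < R → ∀ y ∈ Γ.ball x R,
    Γ.meanExit x (2 * R) ≤ C * Γ.meanExit y R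

/-- `C⁻¹ a ≤ b ≤ C a`. -/
def ComparableWith (C : ℝ≥0) (a b : ℝ≥0∞) : Prop := (C : ℝ≥0∞)⁻¹ * a ≤ b ∧ b ≤ C * a

end

end WeightedGraph

/-! Everything is read off from `h = exitFunction A`, the mean exit time from a finite set `A`. It
vanishes outside `A` and solves the Poisson equation `-Δh = 1` on `A`
(`neg_laplacian_exitFunction`). It is finite because `(p₀)` makes balls finite and supplies a
Lyapunov function.

For `A = B(x,2R)`, inclusion of balls and (TC) control `h` by the single number `E = E(x,2R)`: `h ≤
cE` everywhere (`maxMeanExit_le`) and `h ≥ E/c` on `B(x,R)` (`meanExit_le_meanExitFrom`). The first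
bound already gives `Ē ≃ E`.

Eigenvalue: comparing an eigenfunction with `h` (Barta) gives `λ⁻¹ ≤ Ē`. Conversely, `h` in the
Rayleigh quotient, with (VD) to compare `B(x,R)` and `B(x,2R)`, gives `E ≤ c³D λ⁻¹`.

Resistance: a competitor for `ρ` equals `1` on `B(x,R)`, so its energy is at least `λV(x,R)`, whence
`ρV(x,R) ≤ λ⁻¹`. Conversely, `min (ch/E) 1` is a competitor of energy at most `(c/E)V(x,2R)`, whence
`E ≤ cρV(x,2R)`. Finally (VD) makes `V(x,R)`, `V(x,2R)` and `v(x,R,2R)` comparable, because for `R >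
1/2` the annulus contains a ball of radius `R/4`. -/

namespace WeightedGraph

noncomputable section

variable {V : Type*}

/-! ### The mean exit time as a Green potential -/

/-- The indicator of the event that a trajectory stays in `A` up to time `k`. -/
def stayIndicator (A : Set V) (k : ℕ) (ω : ℕ → V) : ℝ≥0∞ :=
  ∏ i ∈ Finset.range (k + 1), A.indicator 1 (ω i)

lemma stayIndicator_eq_one {A : Set V} {k : ℕ} {ω : ℕ → V} (h : ∀ i ≤ k, ω i ∈ A) :
    stayIndicator A k ω = 1 :=
  Finset.prod_eq_one fun i hi => by
    simp [h i (Nat.lt_succ_iff.1 (Finset.mem_range.1 hi))]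

lemma stayIndicator_eq_zero {A : Set V} {k i : ℕ} {ω : ℕ → V} (hi : i ≤ k) (h : ω i ∉ A) :
    stayIndicator A k ω = 0 :=
  Finset.prod_eq_zero (Finset.mem_range.2 (Nat.lt_succ_iff.2 hi)) (by simp [h])

/-- The exit time counts the times `k` up to which the trajectory has not yet left `A`; if it never
leaves, both sides are infinite. -/
lemma exitTime_eq_tsum (A : Set V) (ω : ℕ → V) :
    exitTime A ω = ∑' k, stayIndicator A k ω := by
  classical
  by_cases h : ∃ m, ω m ∉ A
  · have hlt : ∀ i < Nat.find h, ω i ∈ A := fun i hi => not_not.1 (Nat.find_min h hi)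
    have h1 : exitTime A ω = (Nat.find h : ℝ≥0∞) := by
      refine le_antisymm (iInf₂_le (Nat.find h) (Nat.find_spec h)) (le_iInf₂ fun k hk => ?_)
      exact_mod_cast Nat.find_min' h hk
    rw [h1, tsum_eq_sum (s := Finset.range (Nat.find h))]
    · rw [Finset.sum_congr rfl (g := fun _ => (1 : ℝ≥0∞))]
      · simp
      · intro k hk
        exact stayIndicator_eq_one fun i hi => hlt i (lt_of_le_of_lt hi (Finset.mem_range.1 hk))
    · intro k hk
      exact stayIndicator_eq_zero (by simpa using hk) (Nat.find_spec h)
  · push Not at h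
    simp [exitTime, h, stayIndicator_eq_one]

lemma exitTime_mono {A B : Set V} (h : A ⊆ B) (ω : ℕ → V) : exitTime A ω ≤ exitTime B ω :=
  le_iInf₂ fun k hk => iInf₂_le k fun hA => hk (h hA)

lemma measurable_stayIndicator [MeasurableSpace V] [DiscreteMeasurableSpace V] (A : Set V)
    (k : ℕ) :
    Measurable (stayIndicator A k : (ℕ → V) → ℝ≥0∞) := by
  have : Measurable (A.indicator (1 : V → ℝ≥0∞)) := Measurable.of_discrete
  unfold stayIndicator
  fun_prop

variable [Infinite V]

/-- The averaging operator `P g` on `[0, ∞]`-valued functions. -/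
def averaging (Γ : WeightedGraph V) (g : V → ℝ≥0∞) (x : V) : ℝ≥0∞ := ∑' y, Γ.stepPMF x y * g y

/-- The transition operator of the walk killed on leaving `A`. -/
def killedStep (Γ : WeightedGraph V) (A : Set V) (g : V → ℝ≥0∞) : V → ℝ≥0∞ :=
  A.indicator (Γ.averaging g)

lemma averaging_mono (Γ : WeightedGraph V) {f g : V → ℝ≥0∞} (h : f ≤ g) :
    Γ.averaging f ≤ Γ.averaging g :=
  fun _ => ENNReal.tsum_le_tsum fun y => mul_le_mul_right (h y) _

lemma averaging_tsum (Γ : WeightedGraph V) (f : ℕ → V → ℝ≥0∞) (x : V) :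
    Γ.averaging (fun y => ∑' k, f k y) x = ∑' k, Γ.averaging (f k) x := by
  simp only [averaging, ← ENNReal.tsum_mul_left]
  exact ENNReal.tsum_comm

variable [MeasurableSpace V] [DiscreteMeasurableSpace V]

lemma walkLaw_start (Γ : WeightedGraph V) (z : V) (g : V → ℝ≥0∞) :
    ∫⁻ ω, g (ω 0) ∂Γ.walkLaw z = g z := by
  have hg : Measurable g := Measurable.of_discrete
  have h : ∫⁻ ω, g (ω 0) ∂Γ.walkLaw z =
      ∫⁻ p, g (p ⟨0, Finset.mem_Iic.2 le_rfl⟩) ∂((Γ.walkLaw z).map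
        (Preorder.frestrictLe (π := fun _ => V) 0)) := by
    rw [lintegral_map (by fun_prop) (by fun_prop)]
    rfl
  rw [h, walkLaw, Kernel.traj_map_frestrictLe_apply, Kernel.partialTraj_self, Kernel.id_apply,
    lintegral_dirac' _ (by fun_prop)]

lemma meanExitFrom_mono (Γ : WeightedGraph V) (z : V) {A B : Set V} (h : A ⊆ B) :
    Γ.meanExitFrom z A ≤ Γ.meanExitFrom z B :=
  lintegral_mono fun ω => exitTime_mono h ω

variable [Countable V]

lemma lintegral_stepKernel (Γ : WeightedGraph V) (g : V → ℝ≥0∞) (x : V) :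
    ∫⁻ y, g y ∂Γ.stepKernel x = Γ.averaging g x := by
  rw [lintegral_countable']
  refine tsum_congr fun y => ?_
  change _ * (Γ.stepPMF x).toMeasure {y} = _
  rw [PMF.toMeasure_apply_singleton _ _ (measurableSet_singleton y), mul_comm]

/-- The Markov property at time `k`, for functionals of the past times a function of `X_{k+1}`. -/
lemma lintegral_walkLaw_succ (Γ : WeightedGraph V) (z : V) (k : ℕ)
    {F : ((_ : Finset.Iic k) → V) → ℝ≥0∞} (hF : Measurable F) (g : V → ℝ≥0∞) :
    ∫⁻ ω, F (Preorder.frestrictLe (π := fun _ => V) k ω) * g (ω (k + 1)) ∂Γ.walkLaw z =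
      ∫⁻ ω, F (Preorder.frestrictLe (π := fun _ => V) k ω) * Γ.averaging g (ω k)
        ∂Γ.walkLaw z := by
  have hg : Measurable g := Measurable.of_discrete
  -- The joint law of the path up to time `k` and of `X_{k+1}` is the law of that path composed with
  -- `historyKernel`.
  have hm := Kernel.partialTraj_compProd_eq_map_traj (X := fun _ => V) (κ := Γ.historyKernel)
    (Nat.zero_le k) (x₀ := fun _ => z)
  have hG : Measurable fun p : ((_ : Finset.Iic k) → V) × V => F p.1 * g p.2 := by fun_prop
  have h1 : ∫⁻ ω, F (Preorder.frestrictLe (π := fun _ => V) k ω) * g (ω (k + 1)) ∂Γ.walkLaw z =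
      ∫⁻ p, F p.1 * g p.2 ∂((Γ.walkLaw z).map fun ω =>
        (Preorder.frestrictLe (π := fun _ => V) k ω, ω (k + 1))) := by
    rw [lintegral_map hG (by fun_prop)]
  have hA : Measurable (Γ.averaging g) := Measurable.of_discrete
  rw [h1, walkLaw, ← hm, Measure.lintegral_compProd hG,
    ← Kernel.traj_map_frestrictLe_apply, lintegral_map (by fun_prop) (by fun_prop)]
  refine lintegral_congr fun ω => ?_
  dsimp only
  rw [lintegral_const_mul _ hg, historyKernel, Kernel.comap_apply, lintegral_stepKernel]
  rfl

/-- By the Markov property the last step can be integrated out, which replaces `g` by the average of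
`A.indicator g`; hence the induction runs over all `g`. -/
lemma lintegral_stayIndicator_mul (Γ : WeightedGraph V) (A : Set V) (z : V) (k : ℕ)
    (g : V → ℝ≥0∞) :
    ∫⁻ ω, stayIndicator A k ω * g (ω k) ∂Γ.walkLaw z =
      (Γ.killedStep A)^[k] (A.indicator g) z := by
  induction k generalizing g with
  | zero =>
    rw [Function.iterate_zero_apply, ← Γ.walkLaw_start z (A.indicator g)]
    refine lintegral_congr fun ω => ?_
    by_cases h : ω 0 ∈ A <;> simp [stayIndicator, h]
  | succ k ih =>
    have hF : Measurable fun p : ((_ : Finset.Iic k) → V) =>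
        ∏ i : Finset.Iic k, A.indicator (1 : V → ℝ≥0∞) (p i) := by
      have : Measurable (A.indicator (1 : V → ℝ≥0∞)) := Measurable.of_discrete
      fun_prop
    have hFs : ∀ ω : ℕ → V, ∏ i : Finset.Iic k,
        A.indicator (1 : V → ℝ≥0∞) (Preorder.frestrictLe (π := fun _ => V) k ω i) =
        stayIndicator A k ω := by
      intro ω
      have hr : Finset.range (k + 1) = Finset.Iic k := by ext i; simp
      rw [stayIndicator, hr, ← Finset.prod_coe_sort (Finset.Iic k)]
      rfl
    have h := Γ.lintegral_walkLaw_succ z k hF (A.indicator g)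
    simp only [hFs] at h
    rw [Function.iterate_succ_apply, killedStep, ← ih, ← h]
    refine lintegral_congr fun ω => ?_
    rw [stayIndicator, Finset.prod_range_succ, ← stayIndicator, mul_assoc]
    by_cases hω : ω (k + 1) ∈ A <;> simp [hω]

lemma meanExitFrom_eq_tsum (Γ : WeightedGraph V) (A : Set V) (z : V) :
    Γ.meanExitFrom z A = ∑' k, (Γ.killedStep A)^[k] (A.indicator 1) z := by
  simp only [meanExitFrom, exitTime_eq_tsum]
  rw [lintegral_tsum fun k => (measurable_stayIndicator A k).aemeasurable]
  refine tsum_congr fun k => ?_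
  rw [← Γ.lintegral_stayIndicator_mul A z k 1]
  simp

/-- First-step analysis of the mean exit time. -/
lemma meanExitFrom_of_mem (Γ : WeightedGraph V) {A : Set V} {z : V} (hz : z ∈ A) :
    Γ.meanExitFrom z A = 1 + Γ.averaging (fun y => Γ.meanExitFrom y A) z := by
  simp only [meanExitFrom_eq_tsum]
  rw [tsum_eq_zero_add' ENNReal.summable, averaging_tsum]
  simp [Function.iterate_succ_apply', killedStep, hz]

lemma meanExitFrom_of_notMem (Γ : WeightedGraph V) {A : Set V} {z : V} (hz : z ∉ A) :
    Γ.meanExitFrom z A = 0 := by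
  rw [meanExitFrom_eq_tsum, ENNReal.tsum_eq_zero]
  rintro (_ | k)
  · simp [hz]
  · simp [Function.iterate_succ_apply', killedStep, hz]

/-- The mean exit time is the smallest supersolution. -/
lemma meanExitFrom_le_of_supersolution (Γ : WeightedGraph V) {A : Set V} {w : V → ℝ≥0∞}
    (hw : ∀ z ∈ A, 1 + Γ.averaging w z ≤ w z) (z : V) : Γ.meanExitFrom z A ≤ w z := by
  rw [meanExitFrom_eq_tsum]
  -- The partial sums satisfy `S_{n+1} = 1 + P S_n` on `A` and vanish off `A`, so `S_n ≤ w`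
  -- propagates from `S_0 = 0`.
  refine ENNReal.tsum_le_of_sum_range_le fun n => ?_
  induction n generalizing z with
  | zero => simp
  | succ n ih =>
    by_cases hz : z ∈ A
    · refine le_trans ?_ (hw z hz)
      have hle := Γ.averaging_mono (f := fun y => ∑ k ∈ Finset.range n,
        (Γ.killedStep A)^[k] (A.indicator 1) y) ih z
      refine le_trans ?_ (add_le_add_right hle 1)
      rw [Finset.sum_range_succ', add_comm]
      have : Γ.averaging (fun y => ∑ k ∈ Finset.range n,
          (Γ.killedStep A)^[k] (A.indicator 1) y) z =
          ∑ k ∈ Finset.range n, Γ.averaging ((Γ.killedStep A)^[k] (A.indicator 1)) z := by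
        simp only [averaging, Finset.mul_sum]
        exact Summable.tsum_finsetSum fun _ _ => ENNReal.summable
      rw [this]
      simp [Function.iterate_succ_apply', killedStep, hz]
    · refine le_trans (le_of_eq (Finset.sum_eq_zero fun k _ => ?_)) zero_le
      cases k with
      | zero => simp [hz]
      | succ k => simp [Function.iterate_succ_apply', killedStep, hz]

end

noncomputable section

variable {V : Type*}

/-! ### Finiteness of balls -/

lemma exists_adj_dist_eq (Γ : WeightedGraph V) {z o : V} {n : ℕ} (h : Γ.graph.dist z o = n + 1) :
    ∃ y, Γ.graph.Adj z y ∧ Γ.graph.dist y o = n := by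
  obtain ⟨p, hp⟩ := Γ.connected.exists_walk_length_eq_dist z o
  cases p with
  | nil => simp at h
  | @cons _ y _ hadj q =>
    refine ⟨y, hadj, le_antisymm ?_ ?_⟩
    · have := SimpleGraph.dist_le q
      rw [SimpleGraph.Walk.length_cons] at hp
      omega
    · have h1 := Γ.connected.dist_triangle (u := z) (v := y) (w := o)
      have h2 := SimpleGraph.dist_eq_one_iff_adj.2 hadj
      omega

/-- The transition probabilities from `x` are summable, so only finitely many of them can be at
least `p₀`. -/
lemma finite_neighborSet (Γ : WeightedGraph V) [Infinite V] (hp : Γ.ControlledWeights) (x : V) :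
    {y | Γ.graph.Adj x y}.Finite := by
  obtain ⟨p, hp0, hp⟩ := hp
  have h := (Γ.hasSum_transition x).summable.tendsto_cofinite_zero.eventually_lt_const hp0
  rw [Filter.eventually_cofinite] at h
  exact h.subset fun y hy => not_lt.2 (hp x y hy)

lemma finite_setOf_dist_le (Γ : WeightedGraph V) [Infinite V] (hp : Γ.ControlledWeights) (x : V)
    (n : ℕ) : {y | Γ.graph.dist y x ≤ n}.Finite := by
  induction n with
  | zero =>
    refine (Set.finite_singleton x).subset fun y hy => ?_
    exact Γ.connected.dist_eq_zero_iff.1 (Nat.le_zero.1 hy)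
  | succ n ih =>
    refine (ih.union (ih.biUnion fun z _ => Γ.finite_neighborSet hp z)).subset fun y hy => ?_
    rcases Nat.le_succ_iff.1 hy with h | h
    · exact Or.inl h
    · obtain ⟨z, hadj, hz⟩ := Γ.exists_adj_dist_eq h
      exact Or.inr (Set.mem_biUnion (show z ∈ {y | _} from hz.le) hadj.symm)

lemma finite_ball (Γ : WeightedGraph V) [Infinite V] (hp : Γ.ControlledWeights) (x : V) (R : ℝ) :
    (Γ.ball x R).Finite := by
  refine (Γ.finite_setOf_dist_le hp x ⌈R⌉₊).subset fun y hy => ?_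
  have h : (Γ.graph.dist x y : ℝ) < R := hy
  rw [Set.mem_ofPred_eq, SimpleGraph.dist_comm]
  exact_mod_cast h.le.trans (Nat.le_ceil R)

/-- Balls are finite and the graph is infinite, so some vertex lies beyond distance `n`; a geodesic
from it to `x` passes through every smaller distance. -/
lemma exists_dist_eq (Γ : WeightedGraph V) [Infinite V] (hp : Γ.ControlledWeights) (x : V)
    (n : ℕ) : ∃ y, Γ.graph.dist y x = n := by
  obtain ⟨y, k, hk⟩ : ∃ y k, Γ.graph.dist y x = n + k := by
    obtain ⟨y, hy⟩ := (Γ.finite_setOf_dist_le hp x n).exists_notMem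
    exact ⟨y, Nat.exists_eq_add_of_le (not_le.1 hy).le⟩
  induction k generalizing y with
  | zero => exact ⟨y, hk⟩
  | succ k ih =>
    obtain ⟨z, -, hz⟩ := Γ.exists_adj_dist_eq (n := n + k) hk
    exact ih z hz

lemma mem_ball_self (Γ : WeightedGraph V) (x : V) {R : ℝ} (hR : 0 < R) : x ∈ Γ.ball x R := by
  simpa [ball] using hR

lemma mem_ball_comm (Γ : WeightedGraph V) {x y : V} {R : ℝ} :
    y ∈ Γ.ball x R ↔ x ∈ Γ.ball y R := by
  simp [ball, SimpleGraph.dist_comm]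

lemma ball_subset_ball (Γ : WeightedGraph V) {x y : V} {r R : ℝ}
    (h : Γ.graph.dist x y + r ≤ R) : Γ.ball y r ⊆ Γ.ball x R := by
  intro z hz
  have h1 : (Γ.graph.dist y z : ℝ) < r := hz
  have h2 : (Γ.graph.dist x z : ℝ) ≤ Γ.graph.dist x y + Γ.graph.dist y z := by
    exact_mod_cast Γ.connected.dist_triangle
  change (Γ.graph.dist x z : ℝ) < R
  linarith

/-! ### Finiteness of mean exit times -/

variable [Infinite V]

lemma averaging_ofReal_eq (Γ : WeightedGraph V) {f : V → ℝ} (hf : ∀ y, 0 ≤ f y) {x : V}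
    (hs : Summable fun y => Γ.transition x y * f y) :
    Γ.averaging (fun y => ENNReal.ofReal (f y)) x =
      ENNReal.ofReal (∑' y, Γ.transition x y * f y) := by
  rw [ENNReal.ofReal_tsum_of_nonneg (fun y => mul_nonneg (Γ.transition_nonneg x y) (hf y)) hs]
  refine tsum_congr fun y => ?_
  rw [ENNReal.ofReal_mul (Γ.transition_nonneg x y)]
  rfl

variable [MeasurableSpace V] [DiscreteMeasurableSpace V]

/-- The mean exit time from `A` as a real function of the starting point. -/
def exitFunction (Γ : WeightedGraph V) (A : Set V) (z : V) : ℝ := (Γ.meanExitFrom z A).toReal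

lemma exitFunction_nonneg (Γ : WeightedGraph V) (A : Set V) (z : V) : 0 ≤ Γ.exitFunction A z :=
  ENNReal.toReal_nonneg

variable [Countable V]

/-- A finite supersolution suffices. With `d` the distance to a point `o ∉ A`, take `w = K(1 -
e^d)`: a step towards `o` has probability at least `p`, which makes `e^d` grow on average. -/
lemma meanExitFrom_ne_top (Γ : WeightedGraph V) (hp : Γ.ControlledWeights) {A : Set V}
    (hA : A.Finite) (z : V) : Γ.meanExitFrom z A ≠ ∞ := by
  obtain ⟨p, hp0, hp⟩ := hp
  obtain ⟨o, ho⟩ := hA.exists_notMem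
  have hp1 : p ≤ 1 := by
    obtain ⟨y, hy⟩ := Γ.connected.preconnected.exists_adj_of_nontrivial o
    exact (hp o y hy).trans
      ((le_hasSum (Γ.hasSum_transition o) y fun j _ => Γ.transition_nonneg o j))
  -- With this value `P(e^d) ≥ p e^(d-1) = 2e^d`, so `-Δw ≥ K e^d`; `K` is then chosen to make this
  -- at least `1` on the finite set `A`.
  set e : ℝ := p / 2 with he
  have he0 : 0 < e := by positivity
  have he1 : e ≤ 1 := by linarith
  let d : V → ℕ := fun y => Γ.graph.dist y o
  obtain ⟨K, hK⟩ : ∃ K : ℝ, ∀ z ∈ A, 1 ≤ K * e ^ d z := by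
    obtain ⟨K, hK⟩ := (hA.image fun z => (e ^ d z)⁻¹).bddAbove
    refine ⟨K, fun z hz => ?_⟩
    have := hK (Set.mem_image_of_mem _ hz)
    rwa [inv_le_iff_one_le_mul₀ (by positivity)] at this
  by_cases hne : A.Nonempty
  swap
  · rw [Γ.meanExitFrom_of_notMem fun hz => hne ⟨z, hz⟩]
    simp
  have hK0 : 0 ≤ K := by
    obtain ⟨a, ha⟩ := hne
    have h := hK a ha
    by_contra! hneg
    have := mul_neg_of_neg_of_pos hneg (pow_pos he0 (d a))
    linarith
  have hle : ∀ y, e ^ d y ≤ 1 := fun y => pow_le_one₀ he0.le he1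
  let w : V → ℝ := fun y => K * (1 - e ^ d y)
  have hw0 : ∀ y, 0 ≤ w y := fun y => mul_nonneg hK0 (by linarith [hle y])
  refine ne_top_of_le_ne_top ENNReal.ofReal_ne_top
    (Γ.meanExitFrom_le_of_supersolution (w := fun y => ENNReal.ofReal (w y)) (fun x hx => ?_) z)
  have hs : Summable fun y => Γ.transition x y * e ^ d y :=
    Summable.of_nonneg_of_le (fun y => mul_nonneg (Γ.transition_nonneg x y) (by positivity))
      (fun y => mul_le_of_le_one_right (Γ.transition_nonneg x y) (hle y))
      (Γ.hasSum_transition x).summable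
  have hsum : HasSum (fun y => Γ.transition x y * w y)
      (K * (1 - ∑' y, Γ.transition x y * e ^ d y)) := by
    have := ((Γ.hasSum_transition x).sub hs.hasSum).mul_left K
    refine this.congr_fun fun y => ?_
    simp only [w]
    ring
  rw [Γ.averaging_ofReal_eq hw0 hsum.summable, hsum.tsum_eq, ← ENNReal.ofReal_one,
    ← ENNReal.ofReal_add zero_le_one]
  · apply ENNReal.ofReal_le_ofReal
    obtain ⟨n, hn⟩ : ∃ n, d x = n + 1 := by
      refine Nat.exists_eq_succ_of_ne_zero fun h0 => ho ?_
      rwa [← Γ.connected.dist_eq_zero_iff.1 h0]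
    obtain ⟨y, hadj, hy⟩ := Γ.exists_adj_dist_eq hn
    have h1 : p * e ^ n ≤ ∑' y, Γ.transition x y * e ^ d y := by
      refine le_trans ?_ (hs.le_tsum y fun j _ =>
        mul_nonneg (Γ.transition_nonneg x j) (by positivity))
      change _ ≤ _ * e ^ (Γ.graph.dist y o)
      rw [hy]
      exact mul_le_mul_of_nonneg_right (hp x y hadj) (by positivity)
    have h2 := hK x hx
    have h3 := mul_le_mul_of_nonneg_left h1 hK0
    have h4 : K * (p * e ^ n) = 2 * (K * e ^ d x) := by
      rw [hn, pow_succ, he]; ring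
    simp only [w]
    linarith
  · refine hsum.nonneg fun y => mul_nonneg (Γ.transition_nonneg x y) (hw0 y)

lemma exitFunction_of_notMem (Γ : WeightedGraph V) {A : Set V} {z : V} (hz : z ∉ A) :
    Γ.exitFunction A z = 0 := by
  simp [exitFunction, Γ.meanExitFrom_of_notMem hz]

lemma one_le_meanExitFrom (Γ : WeightedGraph V) {A : Set V} {z : V} (hz : z ∈ A) :
    1 ≤ Γ.meanExitFrom z A := by
  rw [Γ.meanExitFrom_of_mem hz]
  exact le_self_add

lemma exitFunction_pos (Γ : WeightedGraph V) (hp : Γ.ControlledWeights) {A : Set V}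
    (hA : A.Finite) {z : V} (hz : z ∈ A) : 0 < Γ.exitFunction A z :=
  ENNReal.toReal_pos (zero_lt_one.trans_le (Γ.one_le_meanExitFrom hz)).ne'
    (Γ.meanExitFrom_ne_top hp hA z)

/-- The mean exit time solves the Poisson equation `-Δ h = 1` on `A`. -/
lemma neg_laplacian_exitFunction (Γ : WeightedGraph V) (hp : Γ.ControlledWeights) {A : Set V}
    (hA : A.Finite) {z : V} (hz : z ∈ A) : -Γ.laplacian (Γ.exitFunction A) z = 1 := by
  have hfin : Γ.averaging (fun y => Γ.meanExitFrom y A) z ≠ ∞ := by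
    refine ne_top_of_le_ne_top (Γ.meanExitFrom_ne_top hp hA z) ?_
    rw [Γ.meanExitFrom_of_mem hz]
    exact le_add_self
  have h := congrArg ENNReal.toReal (Γ.meanExitFrom_of_mem hz)
  rw [ENNReal.toReal_add ENNReal.one_ne_top hfin, averaging, ENNReal.tsum_toReal_eq] at h
  · have h2 : ∑' y, (Γ.stepPMF z y * Γ.meanExitFrom y A).toReal =
        ∑' y, Γ.transition z y * Γ.exitFunction A y := by
      refine tsum_congr fun y => ?_
      rw [ENNReal.toReal_mul]
      exact congrArg (· * _) (ENNReal.toReal_ofReal (Γ.transition_nonneg z y))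
    rw [h2] at h
    simp only [laplacian]
    rw [exitFunction, h]
    simp
  · exact fun y => ENNReal.mul_ne_top ENNReal.ofReal_ne_top (Γ.meanExitFrom_ne_top hp hA y)

end

noncomputable section

variable {V : Type*}

/-! ### The Dirichlet form on a finite set -/

lemma tsum_transition_eq_sum (Γ : WeightedGraph V) {s : Finset V} {f : V → ℝ}
    (hf : ∀ x ∉ s, f x = 0) (x : V) :
    ∑' y, Γ.transition x y * f y = ∑ y ∈ s, Γ.transition x y * f y :=
  tsum_eq_sum fun y hy => by rw [hf y hy, mul_zero]

lemma innerProduct_eq_sum (Γ : WeightedGraph V) {s : Finset V} (f : V → ℝ) {g : V → ℝ}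
    (hg : ∀ x ∉ s, g x = 0) :
    Γ.innerProduct f g = ∑ x ∈ s, f x * g x * Γ.vertexMeasure x :=
  tsum_eq_sum fun y hy => by rw [hg y hy, mul_zero, zero_mul]

variable [Infinite V]

lemma transition_mul_vertexMeasure (Γ : WeightedGraph V) (x y : V) :
    Γ.transition x y * Γ.vertexMeasure x = Γ.weight x y :=
  div_mul_cancel₀ _ (Γ.vertexMeasure_pos x).ne'

/-- Both sides equal a diagonal sum minus the bilinear form of the symmetric weights. -/
lemma innerProduct_laplacian_comm (Γ : WeightedGraph V) {s : Finset V} {f g : V → ℝ}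
    (hf : ∀ x ∉ s, f x = 0) (hg : ∀ x ∉ s, g x = 0) :
    Γ.innerProduct (fun x => -Γ.laplacian f x) g =
      Γ.innerProduct (fun x => -Γ.laplacian g x) f := by
  have key : ∀ {f g : V → ℝ}, (∀ x ∉ s, f x = 0) → (∀ x ∉ s, g x = 0) →
      Γ.innerProduct (fun x => -Γ.laplacian f x) g =
        ∑ x ∈ s, f x * g x * Γ.vertexMeasure x -
          ∑ x ∈ s, ∑ y ∈ s, Γ.weight x y * (f y * g x) := by
    intro f g hf hg
    rw [Γ.innerProduct_eq_sum _ hg, ← Finset.sum_sub_distrib]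
    refine Finset.sum_congr rfl fun x _ => ?_
    rw [laplacian, Γ.tsum_transition_eq_sum hf]
    have : ∑ y ∈ s, Γ.weight x y * (f y * g x) =
        (∑ y ∈ s, Γ.transition x y * f y) * (g x * Γ.vertexMeasure x) := by
      rw [Finset.sum_mul]
      refine Finset.sum_congr rfl fun y _ => ?_
      rw [← Γ.transition_mul_vertexMeasure x y]
      ring
    rw [this]
    ring
  rw [key hf hg, key hg hf, Finset.sum_comm]
  congr 1
  · exact Finset.sum_congr rfl fun x _ => by ring
  · refine Finset.sum_congr rfl fun x _ => Finset.sum_congr rfl fun y _ => ?_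
    rw [Γ.weight_symm y x]
    ring

/-- A function has nonnegative `-Δ` at its maximum points. -/
lemma neg_laplacian_nonneg_of_le (Γ : WeightedGraph V) {s : Finset V} {f : V → ℝ}
    (hf : ∀ x ∉ s, f x = 0) {x : V} (hx : ∀ y, f y ≤ f x) : 0 ≤ -Γ.laplacian f x := by
  have h0 : 0 ≤ f x := by
    obtain ⟨y, hy⟩ := s.exists_notMem
    exact (hf y hy).symm.le.trans (hx y)
  have h1 : ∑ y ∈ s, Γ.transition x y * f y ≤ (∑ y ∈ s, Γ.transition x y) * f x := by
    rw [Finset.sum_mul]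
    exact Finset.sum_le_sum fun y _ =>
      mul_le_mul_of_nonneg_left (hx y) (Γ.transition_nonneg x y)
  have h2 : ∑ y ∈ s, Γ.transition x y ≤ 1 :=
    sum_le_hasSum s (fun y _ => Γ.transition_nonneg x y) (Γ.hasSum_transition x)
  have h3 := mul_le_of_le_one_left h0 h2
  rw [laplacian, Γ.tsum_transition_eq_sum hf]
  linarith

/-- Truncation at level `1` estimates the energy of `u ∧ 1` by `(-Δ u, u ∧ 1)`. -/
lemma innerProduct_laplacian_min_one_le (Γ : WeightedGraph V) {s : Finset V} {u : V → ℝ}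
    (hu0 : ∀ x ∉ s, u x = 0) :
    Γ.innerProduct (fun x => -Γ.laplacian (fun y => min (u y) 1) x) (fun y => min (u y) 1) ≤
      Γ.innerProduct (fun x => -Γ.laplacian u x) (fun y => min (u y) 1) := by
  have hm : ∀ x ∉ s, min (u x) 1 = 0 := fun x hx => by simp [hu0 x hx]
  -- Moving `Δ` onto the truncation leaves a pointwise comparison: equality where `u ≤ 1`, and where
  -- `u ≥ 1` the truncation is maximal, so its `-Δ` is nonnegative.
  rw [Γ.innerProduct_laplacian_comm hu0 hm, Γ.innerProduct_eq_sum _ hm,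
    Γ.innerProduct_eq_sum _ hu0]
  refine Finset.sum_le_sum fun x _ => mul_le_mul_of_nonneg_right ?_ (Γ.vertexMeasure_pos x).le
  rcases le_total (u x) 1 with h | h
  · rw [min_eq_left h]
  · have := Γ.neg_laplacian_nonneg_of_le hm (x := x) fun y => by simp [h]
    exact mul_le_mul_of_nonneg_left (min_le_left _ _) this

/-! ### The bottom eigenvalue -/

/-- Some Dirichlet eigenvalue is a lower bound of all Rayleigh quotients. -/
lemma exists_dirichletEigenvalue_le_rayleigh (Γ : WeightedGraph V) {s : Finset V}
    (hs : s.Nonempty) : ∃ l ∈ Γ.dirichletEigenvalues (s : Set V), ∀ f : V → ℝ,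
      (∀ x ∉ s, f x = 0) →
        l * ∑ x ∈ s, f x ^ 2 * Γ.vertexMeasure x ≤
          Γ.innerProduct (fun x => -Γ.laplacian f x) f := by
  classical
  have : Nonempty s := hs.to_subtype
  let m : V → ℝ := fun x => √(Γ.vertexMeasure x)
  have hm : ∀ x, 0 < m x := fun x => Real.sqrt_pos.2 (Γ.vertexMeasure_pos x)
  have hmm : ∀ x, m x * m x = Γ.vertexMeasure x := fun x =>
    Real.mul_self_sqrt (Γ.vertexMeasure_pos x).le
  -- Conjugating `-Δ` by `√μ` gives a symmetric matrix. The substitution `v = f√μ` turns the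
  -- weighted norm into the Euclidean one.
  let M : Matrix s s ℝ := fun x y => (if x = y then 1 else 0) - Γ.weight x y / (m x * m y)
  have hM : M.IsHermitian := by
    ext x y
    change (if y = x then (1 : ℝ) else 0) - Γ.weight y x / (m y * m x) =
      (if x = y then 1 else 0) - Γ.weight x y / (m x * m y)
    rw [Γ.weight_symm y x, mul_comm (m y)]
    simp only [eq_comm (a := y)]
  let T := Matrix.toEuclideanLin M
  have hT : T.IsSymmetric := Matrix.isSymmetric_toEuclideanLin_iff.2 hM
  let lift : EuclideanSpace ℝ s → V → ℝ := fun v x => if h : x ∈ s then v ⟨x, h⟩ / m x else 0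
  have hlift0 : ∀ v, ∀ x ∉ s, lift v x = 0 := fun v x hx => by simp [lift, hx]
  have hlift : ∀ v (x : s), lift v x = v x / m x := fun v x => by simp [lift]
  have hTapp : ∀ v (x : s), T v x = m x * -Γ.laplacian (lift v) x := by
    intro v x
    have h1 : T v x = ∑ y : s, M x y * v y := rfl
    rw [h1, laplacian, Γ.tsum_transition_eq_sum (hlift0 v), ← Finset.sum_coe_sort s]
    simp only [M, sub_mul, Finset.sum_sub_distrib, hlift, ite_mul, one_mul, zero_mul,
      Finset.sum_ite_eq, Finset.mem_univ, if_true]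
    have h2 : ∑ y : s, Γ.weight x y / (m x * m y) * v y =
        m x * ∑ y : s, Γ.transition x y * (v y / m y) := by
      rw [Finset.mul_sum]
      refine Finset.sum_congr rfl fun y _ => ?_
      have hx := (hm x).ne'
      have hy := (hm y).ne'
      rw [transition, ← hmm x]
      field_simp
    rw [h2]
    have hx := (hm x).ne'
    field_simp
    ring
  -- In finite dimension the infimum of the Rayleigh quotients of a symmetric operator is an
  -- eigenvalue.
  have hev := hT.hasEigenvalue_iInf_of_finiteDimensional
  set l : ℝ := ⨅ x : {x : EuclideanSpace ℝ s // x ≠ 0},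
    RCLike.re (inner ℝ (T x) (x : EuclideanSpace ℝ s)) / ‖(x : EuclideanSpace ℝ s)‖ ^ 2 with hl
  refine ⟨l, ?_, ?_⟩
  · obtain ⟨v, hv⟩ := hev.exists_hasEigenvector
    refine ⟨lift v, fun h0 => hv.2 ?_, fun x hx => hlift0 v x (by simpa using hx), ?_⟩
    · ext x
      have h1 := hlift v x
      rw [h0, Pi.zero_apply, eq_comm, div_eq_zero_iff] at h1
      simpa [(hm x).ne'] using h1
    · intro x hx
      have hx : x ∈ s := by simpa using hx
      have h1 := hTapp v ⟨x, hx⟩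
      rw [hv.apply_eq_smul] at h1
      have h2 : l * v ⟨x, hx⟩ = m x * -Γ.laplacian (lift v) x := h1
      have h3 : lift v x = v ⟨x, hx⟩ / m x := hlift v ⟨x, hx⟩
      rw [h3, mul_div_assoc', h2, mul_div_cancel_left₀ _ (hm x).ne']
  · intro f hf
    let v : EuclideanSpace ℝ s := WithLp.toLp 2 fun x => f x * m x
    have hlv : lift v = f := by
      ext x
      by_cases hx : x ∈ s
      · have h3 : lift v x = f x * m x / m x := hlift v ⟨x, hx⟩
        rw [h3, mul_div_cancel_right₀ _ (hm x).ne']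
      · rw [hf x hx, hlift0 v x hx]
    have hn : ‖v‖ ^ 2 = ∑ x ∈ s, f x ^ 2 * Γ.vertexMeasure x := by
      rw [EuclideanSpace.norm_sq_eq, ← Finset.sum_coe_sort s]
      refine Finset.sum_congr rfl fun x _ => ?_
      change ‖f x * m x‖ ^ 2 = _
      rw [Real.norm_eq_abs, sq_abs, mul_pow, sq (m x), hmm]
    have hi : inner ℝ (T v) v = Γ.innerProduct (fun x => -Γ.laplacian f x) f := by
      rw [Γ.innerProduct_eq_sum _ hf, ← Finset.sum_coe_sort s, PiLp.inner_apply]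
      refine Finset.sum_congr rfl fun x _ => ?_
      rw [hTapp, hlv, ← hmm]
      change (f x * m x) * (m x * -Γ.laplacian f x) = _
      ring
    by_cases hv : v = 0
    · rw [← hn, ← hi, hv]
      simp
    · have hbdd : BddBelow (Set.range fun x : {x : EuclideanSpace ℝ s // x ≠ 0} =>
          RCLike.re (inner ℝ (T x) (x : EuclideanSpace ℝ s)) /
            ‖(x : EuclideanSpace ℝ s)‖ ^ 2) := by
        refine ⟨-‖T.toContinuousLinearMap‖, ?_⟩
        rintro _ ⟨⟨x, hx⟩, rfl⟩
        have hx0 : 0 < ‖x‖ ^ 2 := by positivity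
        dsimp only
        rw [le_div_iff₀ hx0]
        have h1 := abs_real_inner_le_norm (T x) x
        have h2 : ‖T x‖ ≤ ‖T.toContinuousLinearMap‖ * ‖x‖ := T.toContinuousLinearMap.le_opNorm x
        have h3 := mul_le_mul_of_nonneg_right h2 (norm_nonneg x)
        have h4 := neg_abs_le (inner ℝ (T x) x)
        change _ ≤ inner ℝ (T x) x
        nlinarith
      have h := ciInf_le hbdd ⟨v, hv⟩
      have hx0 : 0 < ‖v‖ ^ 2 := by positivity
      rw [← hl, le_div_iff₀ hx0] at h
      rw [← hn, ← hi]
      exact h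

variable [MeasurableSpace V] [DiscreteMeasurableSpace V] [Countable V]

/-- Barta's inequality with the mean exit time as the comparison function. -/
lemma one_le_dirichletEigenvalue_mul (Γ : WeightedGraph V) (hp : Γ.ControlledWeights)
    {s : Finset V} {l : ℝ} (hl : l ∈ Γ.dirichletEigenvalues (s : Set V)) :
    ∃ z ∈ s, 1 ≤ l * Γ.exitFunction s z := by
  obtain ⟨f, hne, hf0, hf⟩ := hl
  have hf0 : ∀ x ∉ s, f x = 0 := fun x hx => hf0 x (by simpa using hx)
  have hfin : (s : Set V).Finite := s.finite_toSet
  set h := Γ.exitFunction (s : Set V) with hh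
  have hpos : ∀ z ∈ s, 0 < h z := fun z hz => Γ.exitFunction_pos hp hfin (by simpa using hz)
  have hh0 : ∀ z ∉ s, h z = 0 := fun z hz => Γ.exitFunction_of_notMem (by simpa using hz)
  obtain ⟨a, ha⟩ : ∃ a, f a ≠ 0 := by
    by_contra! hall
    exact hne (funext hall)
  have has : a ∈ s := by
    by_contra hcon
    exact ha (hf0 a hcon)
  -- At a maximum point `z` of `|f|/h`, with value `t`, the bound `|f| ≤ t h` is an equality.
  obtain ⟨z, hz, hmax⟩ := s.exists_max_image (fun x => |f x| / h x) ⟨a, has⟩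
  set t := |f z| / h z with ht
  have ht0 : 0 < t := (div_pos (abs_pos.2 ha) (hpos a has)).trans_le (hmax a has)
  have hle : ∀ x, |f x| ≤ t * h x := by
    intro x
    by_cases hx : x ∈ s
    · exact (div_le_iff₀ (hpos x hx)).1 (hmax x hx)
    · simp [hf0 x hx, hh0 x hx]
  have hzt : |f z| = t * h z := by rw [ht, div_mul_cancel₀ _ (hpos z hz).ne']
  refine ⟨z, hz, ?_⟩
  have h1 : h z - ∑ y ∈ s, Γ.transition z y * h y = 1 := by
    have := Γ.neg_laplacian_exitFunction hp hfin (z := z) (by simpa using hz)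
    rw [laplacian, Γ.tsum_transition_eq_sum hh0] at this
    linarith
  have h2 : f z - ∑ y ∈ s, Γ.transition z y * f y = l * f z := by
    have := hf z (by simpa using hz)
    rw [laplacian, Γ.tsum_transition_eq_sum hf0] at this
    linarith
  have h3 : |∑ y ∈ s, Γ.transition z y * f y| ≤ t * ∑ y ∈ s, Γ.transition z y * h y := by
    rw [Finset.mul_sum]
    refine (Finset.abs_sum_le_sum_abs _ _).trans (Finset.sum_le_sum fun y _ => ?_)
    rw [abs_mul, abs_of_nonneg (Γ.transition_nonneg z y)]
    have := mul_le_mul_of_nonneg_left (hle y) (Γ.transition_nonneg z y)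
    linarith
  -- Here `|Pf(z)| ≤ t Ph(z) = t(h(z) - 1) = |f(z)| - t`, while `l f(z) = f(z) - Pf(z)`.
  have h4 : t ≤ l * |f z| := by
    rcases abs_le.1 h3 with ⟨h5, h6⟩
    rcases abs_cases (f z) with ⟨h7, -⟩ | ⟨h7, -⟩
    · rw [h7] at hzt ⊢
      nlinarith
    · rw [h7] at hzt ⊢
      nlinarith
  rw [hzt] at h4
  by_contra! hcon
  nlinarith

/-- A real `sInf` bounds its set from below only if the set is bounded below; Barta's inequality
excludes negative eigenvalues. -/
lemma bottomEigenvalue_le (Γ : WeightedGraph V) (hp : Γ.ControlledWeights) {s : Finset V} {l : ℝ}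
    (hl : l ∈ Γ.dirichletEigenvalues (s : Set V)) : Γ.bottomEigenvalue s ≤ l := by
  refine csInf_le ⟨0, fun k hk => ?_⟩ hl
  obtain ⟨z, -, hz⟩ := Γ.one_le_dirichletEigenvalue_mul hp hk
  by_contra! hneg
  have := mul_nonpos_of_nonpos_of_nonneg hneg.le (Γ.exitFunction_nonneg s z)
  linarith

lemma bottomEigenvalue_mul_sum_le (Γ : WeightedGraph V) (hp : Γ.ControlledWeights)
    {s : Finset V} {f : V → ℝ} (hf : ∀ x ∉ s, f x = 0) :
    Γ.bottomEigenvalue s * ∑ x ∈ s, f x ^ 2 * Γ.vertexMeasure x ≤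
      Γ.innerProduct (fun x => -Γ.laplacian f x) f := by
  rcases s.eq_empty_or_nonempty with rfl | hs
  · rw [Γ.innerProduct_eq_sum _ hf]
    simp
  · obtain ⟨l, hl, h⟩ := Γ.exists_dirichletEigenvalue_le_rayleigh hs
    refine le_trans (mul_le_mul_of_nonneg_right (Γ.bottomEigenvalue_le hp hl) ?_) (h f hf)
    exact Finset.sum_nonneg fun x _ => mul_nonneg (sq_nonneg _) (Γ.vertexMeasure_pos x).le

lemma one_le_bottomEigenvalue_mul (Γ : WeightedGraph V) (hp : Γ.ControlledWeights)
    {s : Finset V} (hs : s.Nonempty) {M : ℝ} (hM : ∀ z ∈ s, Γ.exitFunction s z ≤ M) :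
    1 ≤ Γ.bottomEigenvalue s * M := by
  obtain ⟨a, ha⟩ := hs
  have hM0 : 0 < M := (Γ.exitFunction_pos hp s.finite_toSet (by simpa using ha)).trans_le (hM a ha)
  rw [← div_le_iff₀ hM0]
  -- An eigenvalue has to exist, since `sInf ∅ = 0` would break the bound.
  obtain ⟨l₀, hl₀, -⟩ := Γ.exists_dirichletEigenvalue_le_rayleigh ⟨a, ha⟩
  refine le_csInf ⟨l₀, hl₀⟩ fun l hl => ?_
  obtain ⟨z, hz, h⟩ := Γ.one_le_dirichletEigenvalue_mul hp hl
  have h0 := Γ.exitFunction_nonneg (s : Set V) z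
  have hl0 : 0 ≤ l := by
    by_contra! hneg
    have := mul_nonpos_of_nonpos_of_nonneg hneg.le h0
    linarith
  rw [div_le_iff₀ hM0]
  exact h.trans (mul_le_mul_of_nonneg_left (hM z hz) hl0)

end

noncomputable section

variable {V : Type*}

lemma ComparableWith.of_le {C k₁ k₂ : ℝ≥0} {a b : ℝ≥0∞} (hC : 0 < C) (h₁ : a ≤ k₁ * b)
    (h₂ : b ≤ k₂ * a) (hk₁ : k₁ ≤ C) (hk₂ : k₂ ≤ C) : ComparableWith C a b := by
  have hk₁' : (k₁ : ℝ≥0∞) ≤ C := by exact_mod_cast hk₁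
  have hk₂' : (k₂ : ℝ≥0∞) ≤ C := by exact_mod_cast hk₂
  refine ⟨?_, h₂.trans (mul_le_mul_left hk₂' _)⟩
  rw [ENNReal.inv_mul_le_iff (by exact_mod_cast hC.ne') ENNReal.coe_ne_top]
  exact h₁.trans (mul_le_mul_left hk₁' _)

/-! ### Volumes -/

lemma setMeasure_mono (Γ : WeightedGraph V) {A B : Set V} (h : A ⊆ B) :
    Γ.setMeasure A ≤ Γ.setMeasure B :=
  ENNReal.tsum_mono_subtype (fun y => ENNReal.ofReal (Γ.vertexMeasure y)) h

lemma setMeasure_union (Γ : WeightedGraph V) {A B : Set V} (h : Disjoint A B) :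
    Γ.setMeasure (A ∪ B) = Γ.setMeasure A + Γ.setMeasure B :=
  ENNReal.summable.tsum_union_disjoint (f := fun y => ENNReal.ofReal (Γ.vertexMeasure y)) h
    ENNReal.summable

variable [Infinite V]

lemma setMeasure_coe (Γ : WeightedGraph V) (s : Finset V) :
    Γ.setMeasure (s : Set V) = ENNReal.ofReal (∑ x ∈ s, Γ.vertexMeasure x) := by
  rw [ENNReal.ofReal_sum_of_nonneg fun x _ => (Γ.vertexMeasure_pos x).le]
  exact Finset.tsum_subtype s fun y => ENNReal.ofReal (Γ.vertexMeasure y)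

lemma exists_coe_eq_ball (Γ : WeightedGraph V) (hp : Γ.ControlledWeights) (x : V) (R : ℝ) :
    ∃ s : Finset V, (s : Set V) = Γ.ball x R :=
  ⟨(Γ.finite_ball hp x R).toFinset, Set.Finite.coe_toFinset _⟩

lemma volume_ne_top (Γ : WeightedGraph V) (hp : Γ.ControlledWeights) (x : V) (R : ℝ) :
    Γ.volume x R ≠ ∞ := by
  obtain ⟨s, hs⟩ := Γ.exists_coe_eq_ball hp x R
  rw [volume, ← hs, setMeasure_coe]
  exact ENNReal.ofReal_ne_top

lemma volume_ne_zero (Γ : WeightedGraph V) (hp : Γ.ControlledWeights) (x : V) {R : ℝ}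
    (hR : 0 < R) : Γ.volume x R ≠ 0 := by
  obtain ⟨s, hs⟩ := Γ.exists_coe_eq_ball hp x R
  have hx : x ∈ s := by
    have := Γ.mem_ball_self x hR
    rwa [← hs, Finset.mem_coe] at this
  rw [volume, ← hs, setMeasure_coe]
  exact (ENNReal.ofReal_pos.2 (Finset.sum_pos (fun y _ => Γ.vertexMeasure_pos y) ⟨x, hx⟩)).ne'

/-- The annulus `B(x,2R) \ B(x,R)` contains a ball of radius `R/4`. -/
lemma exists_ball_subset_annulus (Γ : WeightedGraph V) (hp : Γ.ControlledWeights) (x : V) {R : ℝ}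
    (hR : 1 / 2 < R) : ∃ y ∈ Γ.ball x (2 * R), Γ.ball y (R / 4) ⊆ Γ.ball x (2 * R) ∧
      Disjoint (Γ.ball y (R / 4)) (Γ.ball x R) := by
  -- For `R < 2` the ball of radius `R/4 < 1` is a single point, and an integer in `[R, 2R)` is
  -- needed: this is where `R > 1/2` enters.
  rcases lt_or_ge R 2 with h2 | h2
  · obtain ⟨n, hn1, hn2⟩ : ∃ n : ℕ, R ≤ n ∧ (n : ℝ) < 2 * R := by
      rcases le_or_gt R 1 with h1 | h1
      · exact ⟨1, by simpa using h1, by push_cast; linarith⟩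
      · exact ⟨2, by push_cast; linarith, by push_cast; linarith⟩
    obtain ⟨y, hy⟩ := Γ.exists_dist_eq hp x n
    rw [SimpleGraph.dist_comm] at hy
    have hyb : y ∈ Γ.ball x (2 * R) := by
      change (Γ.graph.dist x y : ℝ) < _
      rwa [hy]
    have hsing : ∀ z ∈ Γ.ball y (R / 4), z = y := by
      intro z hz
      have hz : (Γ.graph.dist y z : ℝ) < R / 4 := hz
      have h1 : (Γ.graph.dist y z : ℝ) < (1 : ℕ) := by push_cast; linarith
      have h0 : Γ.graph.dist y z = 0 := Nat.lt_one_iff.1 (by exact_mod_cast h1)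
      exact (Γ.connected.dist_eq_zero_iff.1 h0).symm
    refine ⟨y, hyb, fun z hz => hsing z hz ▸ hyb, Set.disjoint_left.2 fun z hz hzx => ?_⟩
    rw [hsing z hz] at hzx
    have hzx : (Γ.graph.dist x y : ℝ) < R := hzx
    rw [hy] at hzx
    linarith
  -- For `R ≥ 2` the centre lies at distance between `5R/4` and `5R/4 + 1 ≤ 7R/4`, which leaves room
  -- `R/4` on both sides.
  · have hn1 := Nat.le_ceil (5 / 4 * R)
    have hn2 := Nat.ceil_lt_add_one (show 0 ≤ 5 / 4 * R by linarith)
    obtain ⟨y, hy⟩ := Γ.exists_dist_eq hp x ⌈5 / 4 * R⌉₊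
    rw [SimpleGraph.dist_comm] at hy
    rw [← hy] at hn1 hn2
    refine ⟨y, ?_, Γ.ball_subset_ball (by linarith), Set.disjoint_left.2 fun z hz hzx => ?_⟩
    · change (Γ.graph.dist x y : ℝ) < _
      linarith
    · have hz : (Γ.graph.dist y z : ℝ) < R / 4 := hz
      have hzx : (Γ.graph.dist x z : ℝ) < R := hzx
      have h3 : (Γ.graph.dist x y : ℝ) ≤ Γ.graph.dist x z + Γ.graph.dist z y := by
        exact_mod_cast Γ.connected.dist_triangle
      rw [SimpleGraph.dist_comm (u := z)] at h3
      linarith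

/-- If `B(y,R/4)` lies in the annulus, then `B(x,2R) ⊆ B(y,4R)`, and four doublings lead from `R/4`
to `4R`. -/
lemma volume_le_annulusVolume (Γ : WeightedGraph V) (hp : Γ.ControlledWeights) {D : ℝ≥0}
    (hD : ∀ (x : V) (R : ℝ), 0 < R → Γ.volume x (2 * R) ≤ D * Γ.volume x R) (x : V) {R : ℝ}
    (hR : 1 / 2 < R) : Γ.volume x (2 * R) ≤ D ^ 4 * Γ.annulusVolume x R (2 * R) := by
  obtain ⟨y, hy, hsub, hdisj⟩ := Γ.exists_ball_subset_annulus hp x hR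
  have h1 : Γ.volume y (R / 4) ≤ Γ.annulusVolume x R (2 * R) := by
    refine ENNReal.le_sub_of_add_le_right (Γ.volume_ne_top hp x R) ?_
    rw [volume, volume, ← Γ.setMeasure_union hdisj]
    refine Γ.setMeasure_mono (Set.union_subset hsub (Γ.ball_subset_ball ?_))
    rw [SimpleGraph.dist_self]
    push_cast
    linarith
  have h2 : Γ.volume x (2 * R) ≤ Γ.volume y (2 * (2 * (2 * (2 * (R / 4))))) := by
    refine Γ.setMeasure_mono (Γ.ball_subset_ball ?_)
    have : (Γ.graph.dist x y : ℝ) < 2 * R := hy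
    rw [SimpleGraph.dist_comm]
    linarith
  have hR0 : 0 < R := by linarith
  calc Γ.volume x (2 * R) ≤ Γ.volume y (2 * (2 * (2 * (2 * (R / 4))))) := h2
    _ ≤ D * (D * (D * (D * Γ.volume y (R / 4)))) := by
      refine (hD y _ (by positivity)).trans (mul_le_mul_right ?_ _)
      refine (hD y _ (by positivity)).trans (mul_le_mul_right ?_ _)
      refine (hD y _ (by positivity)).trans (mul_le_mul_right ?_ _)
      exact hD y _ (by positivity)
    _ = D ^ 4 * Γ.volume y (R / 4) := by ring
    _ ≤ D ^ 4 * Γ.annulusVolume x R (2 * R) := mul_le_mul_right h1 _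

variable [MeasurableSpace V] [DiscreteMeasurableSpace V]

/-! ### Comparison of mean exit times -/

lemma meanExit_le_maxMeanExit (Γ : WeightedGraph V) (x : V) {R : ℝ} (hR : 0 < R) :
    Γ.meanExit x R ≤ Γ.maxMeanExit x R :=
  le_iSup₂ (f := fun z (_ : z ∈ Γ.ball x R) => Γ.meanExitFrom z (Γ.ball x R)) x
    (Γ.mem_ball_self x hR)

/-- For `z ∈ B(x,R)` one has `B(x,R) ⊆ B(z,2R)`, and (TC) is applied with centre `z` and comparison
point `x`. -/
lemma maxMeanExit_le (Γ : WeightedGraph V) {c : ℝ≥0}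
    (hc : ∀ (x : V) (R : ℝ), 0 < R → ∀ y ∈ Γ.ball x R, Γ.meanExit x (2 * R) ≤ c * Γ.meanExit y R)
    (x : V) {R : ℝ} (hR : 0 < R) : Γ.maxMeanExit x R ≤ c * Γ.meanExit x R := by
  refine iSup₂_le fun z hz => ?_
  refine (Γ.meanExitFrom_mono z (Γ.ball_subset_ball ?_)).trans
    (hc z R hR x (Γ.mem_ball_comm.1 hz))
  have : (Γ.graph.dist x z : ℝ) < R := hz
  rw [SimpleGraph.dist_comm]
  linarith

lemma meanExit_le_meanExitFrom (Γ : WeightedGraph V) {c : ℝ≥0}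
    (hc : ∀ (x : V) (R : ℝ), 0 < R → ∀ y ∈ Γ.ball x R, Γ.meanExit x (2 * R) ≤ c * Γ.meanExit y R)
    {x y : V} {R : ℝ} (hR : 0 < R) (hy : y ∈ Γ.ball x R) :
    Γ.meanExit x (2 * R) ≤ c * Γ.meanExitFrom y (Γ.ball x (2 * R)) := by
  refine (hc x R hR y hy).trans (mul_le_mul_right (Γ.meanExitFrom_mono y ?_) _)
  have : (Γ.graph.dist x y : ℝ) < R := hy
  exact Γ.ball_subset_ball (by linarith)

variable [Countable V]

/-! ### The bottom eigenvalue and the resistance of a ball -/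

/-- The exit function `h` is the test function in the Rayleigh quotient; its energy is `∑ h μ`
because `-Δh = 1` on `s`. -/
lemma bottomEigenvalue_mul_sq_le (Γ : WeightedGraph V) (hp : Γ.ControlledWeights)
    {s t : Finset V} (hts : t ⊆ s) {a b : ℝ} (ha : 0 ≤ a) (hl : 0 ≤ Γ.bottomEigenvalue s)
    (hat : ∀ z ∈ t, a ≤ Γ.exitFunction s z) (hb : ∀ z ∈ s, Γ.exitFunction s z ≤ b) :
    Γ.bottomEigenvalue s * (a ^ 2 * ∑ z ∈ t, Γ.vertexMeasure z) ≤
      b * ∑ z ∈ s, Γ.vertexMeasure z := by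
  have hmu : ∀ z, 0 ≤ Γ.vertexMeasure z := fun z => (Γ.vertexMeasure_pos z).le
  have h0 : ∀ z ∉ s, Γ.exitFunction s z = 0 := fun z hz =>
    Γ.exitFunction_of_notMem (by simpa using hz)
  have h1 := Γ.bottomEigenvalue_mul_sum_le hp h0
  rw [Γ.innerProduct_eq_sum _ h0] at h1
  refine le_trans (mul_le_mul_of_nonneg_left ?_ hl) (h1.trans ?_)
  · rw [Finset.mul_sum]
    refine le_trans (Finset.sum_le_sum fun z hz => ?_) (Finset.sum_le_sum_of_subset_of_nonneg hts
      fun z _ _ => mul_nonneg (sq_nonneg _) (hmu z))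
    exact mul_le_mul_of_nonneg_right (pow_le_pow_left₀ ha (hat z hz) 2) (hmu z)
  · rw [Finset.mul_sum]
    refine Finset.sum_le_sum fun z hz => mul_le_mul_of_nonneg_right ?_ (hmu z)
    rw [Γ.neg_laplacian_exitFunction hp s.finite_toSet (by simpa using hz), one_mul]
    exact hb z hz

lemma bottomEigenvalue_pos (Γ : WeightedGraph V) (hp : Γ.ControlledWeights) {s : Finset V}
    (hs : s.Nonempty) : 0 < Γ.bottomEigenvalue s := by
  obtain ⟨b, hb⟩ := (s.finite_toSet.image (Γ.exitFunction s)).bddAbove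
  have h := Γ.one_le_bottomEigenvalue_mul hp hs fun z hz =>
    hb (Set.mem_image_of_mem _ (Finset.mem_coe.2 hz))
  obtain ⟨a, ha⟩ := hs
  have hb0 : 0 ≤ b := (Γ.exitFunction_nonneg s a).trans
    (hb (Set.mem_image_of_mem _ (Finset.mem_coe.2 ha)))
  by_contra! hneg
  have := mul_nonpos_of_nonpos_of_nonneg hneg hb0
  linarith

lemma invBottomEigenvalue_le_maxMeanExit (Γ : WeightedGraph V) (hp : Γ.ControlledWeights) (x : V)
    {R : ℝ} (hR : 0 < R) : Γ.invBottomEigenvalue x R ≤ Γ.maxMeanExit x R := by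
  rcases eq_or_ne (Γ.maxMeanExit x R) ∞ with htop | htop
  · rw [htop]
    exact le_top
  obtain ⟨s, hs⟩ := Γ.exists_coe_eq_ball hp x R
  have hne : s.Nonempty := ⟨x, by
    have := Γ.mem_ball_self x hR
    rwa [← hs, Finset.mem_coe] at this⟩
  have h := Γ.one_le_bottomEigenvalue_mul hp hne (M := (Γ.maxMeanExit x R).toReal) fun z hz => by
    refine ENNReal.toReal_mono htop ?_
    rw [hs]
    refine le_iSup₂ (f := fun z (_ : z ∈ Γ.ball x R) => Γ.meanExitFrom z (Γ.ball x R)) z ?_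
    rw [← hs]
    exact Finset.mem_coe.2 hz
  have hpos := Γ.bottomEigenvalue_pos hp hne
  rw [hs] at h hpos
  rw [invBottomEigenvalue, ← ENNReal.ofReal_inv_of_pos hpos, ← ENNReal.ofReal_toReal htop]
  refine ENNReal.ofReal_le_ofReal ?_
  rw [inv_le_iff_one_le_mul₀ hpos, mul_comm]
  exact h

/-- The Rayleigh bound with `a = E/c` on `B(x,R)` and `b = cE` on `B(x,2R)` reads `λ(E/c)² V(x,R) ≤
cE·D V(x,R)`, that is `λE ≤ c³D`. -/
lemma meanExit_le_invBottomEigenvalue (Γ : WeightedGraph V) (hp : Γ.ControlledWeights)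
    {c D : ℝ≥0} (hc0 : 0 < c)
    (hc : ∀ (x : V) (R : ℝ), 0 < R → ∀ y ∈ Γ.ball x R, Γ.meanExit x (2 * R) ≤ c * Γ.meanExit y R)
    (hD : ∀ (x : V) (R : ℝ), 0 < R → Γ.volume x (2 * R) ≤ D * Γ.volume x R) (x : V) {R : ℝ}
    (hR : 0 < R) :
    Γ.meanExit x (2 * R) ≤ c ^ 3 * D * Γ.invBottomEigenvalue x (2 * R) := by
  have h2R : 0 < 2 * R := by positivity
  obtain ⟨s, hs⟩ := Γ.exists_coe_eq_ball hp x (2 * R)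
  obtain ⟨t, ht⟩ := Γ.exists_coe_eq_ball hp x R
  have hts : t ⊆ s := by
    rw [← Finset.coe_subset, hs, ht]
    refine Γ.ball_subset_ball ?_
    rw [SimpleGraph.dist_self]
    push_cast
    linarith
  have hxt : x ∈ t := by
    have := Γ.mem_ball_self x hR
    rwa [← ht, Finset.mem_coe] at this
  have hpos := Γ.bottomEigenvalue_pos hp ⟨x, hts hxt⟩
  have hE : Γ.meanExit x (2 * R) ≠ ∞ := Γ.meanExitFrom_ne_top hp (Γ.finite_ball hp x _) x
  set e := (Γ.meanExit x (2 * R)).toReal with he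
  have he0 : 0 < e := Γ.exitFunction_pos hp (Γ.finite_ball hp x _) (Γ.mem_ball_self x h2R)
  have hc0' : (0 : ℝ) < c := hc0
  have hlow : ∀ z ∈ t, e / c ≤ Γ.exitFunction s z := by
    intro z hz
    have hz : z ∈ Γ.ball x R := by rwa [← ht, Finset.mem_coe]
    have h := Γ.meanExit_le_meanExitFrom hc hR hz
    have h' := ENNReal.toReal_mono (ENNReal.mul_ne_top ENNReal.coe_ne_top
      (Γ.meanExitFrom_ne_top hp (Γ.finite_ball hp x _) z)) h
    rw [ENNReal.toReal_mul, ENNReal.coe_toReal] at h'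
    rw [div_le_iff₀ hc0', hs, mul_comm]
    exact h'
  have hup : ∀ z ∈ s, Γ.exitFunction s z ≤ c * e := by
    intro z hz
    have hz : z ∈ Γ.ball x (2 * R) := by rwa [← hs, Finset.mem_coe]
    have h : Γ.meanExitFrom z (Γ.ball x (2 * R)) ≤ c * Γ.meanExit x (2 * R) :=
      (le_iSup₂ (f := fun z (_ : z ∈ Γ.ball x (2 * R)) => Γ.meanExitFrom z (Γ.ball x (2 * R)))
        z hz).trans (Γ.maxMeanExit_le hc x h2R)
    have h' := ENNReal.toReal_mono (ENNReal.mul_ne_top ENNReal.coe_ne_top hE) h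
    rw [ENNReal.toReal_mul, ENNReal.coe_toReal] at h'
    rw [hs]
    exact h'
  have hV : ∑ z ∈ s, Γ.vertexMeasure z ≤ D * ∑ z ∈ t, Γ.vertexMeasure z := by
    have h := hD x R hR
    rw [volume, volume, ← hs, ← ht, setMeasure_coe, setMeasure_coe,
      ← ENNReal.ofReal_coe_nnreal, ← ENNReal.ofReal_mul D.coe_nonneg] at h
    exact (ENNReal.ofReal_le_ofReal_iff (mul_nonneg D.coe_nonneg
      (Finset.sum_nonneg fun z _ => (Γ.vertexMeasure_pos z).le))).1 h
  have key := Γ.bottomEigenvalue_mul_sq_le hp hts (by positivity) hpos.le hlow hup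
  set l := Γ.bottomEigenvalue (s : Set V) with hl
  have hVt : 0 < ∑ z ∈ t, Γ.vertexMeasure z :=
    Finset.sum_pos (fun z _ => Γ.vertexMeasure_pos z) ⟨x, hxt⟩
  have h1 : l * ((e / c) ^ 2) ≤ c * e * D := by
    have h := key.trans (mul_le_mul_of_nonneg_left hV (by positivity))
    refine le_of_mul_le_mul_right ?_ hVt
    linarith
  have h2 : e ≤ c ^ 3 * D * l⁻¹ := by
    rw [← div_eq_mul_inv, le_div_iff₀ hpos]
    have h3 : l * ((e / c) ^ 2) = (e * l) * (e / c ^ 2) := by ring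
    have h4 : (c : ℝ) * e * D = (c ^ 3 * D) * (e / c ^ 2) := by field_simp
    rw [h3, h4] at h1
    exact le_of_mul_le_mul_right h1 (by positivity)
  rw [invBottomEigenvalue, ← hs, ← hl, ← ENNReal.ofReal_inv_of_pos hpos,
    ← ENNReal.ofReal_toReal hE, ← he]
  refine (ENNReal.ofReal_le_ofReal h2).trans (le_of_eq ?_)
  rw [ENNReal.ofReal_mul (by positivity)]
  congr 1
  rw [ENNReal.ofReal_mul (by positivity), ENNReal.ofReal_pow c.coe_nonneg,
    ENNReal.ofReal_coe_nnreal, ENNReal.ofReal_coe_nnreal]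

/-- A competitor `f` equals `1` on `B(x,r)`, so its energy is at least `λ ∑ f²μ ≥ λV(x,r)`; hence
`1/ρ ≥ λV(x,r)`. -/
lemma annulusResistance_mul_volume_le (Γ : WeightedGraph V) (hp : Γ.ControlledWeights) (x : V)
    {r R : ℝ} (hr : 0 < r) (hrR : r ≤ R) :
    Γ.annulusResistance x r R * Γ.volume x r ≤ Γ.invBottomEigenvalue x R := by
  obtain ⟨s, hs⟩ := Γ.exists_coe_eq_ball hp x R
  obtain ⟨t, ht⟩ := Γ.exists_coe_eq_ball hp x r
  have hts : t ⊆ s := by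
    rw [← Finset.coe_subset, hs, ht]
    refine Γ.ball_subset_ball ?_
    rw [SimpleGraph.dist_self]
    push_cast
    linarith
  have hxt : x ∈ t := by
    have := Γ.mem_ball_self x hr
    rwa [← ht, Finset.mem_coe] at this
  have hpos := Γ.bottomEigenvalue_pos hp ⟨x, hts hxt⟩
  have hV0 := Γ.volume_ne_zero hp x hr
  have hVt := Γ.volume_ne_top hp x r
  rw [hs] at hpos
  have h : ENNReal.ofReal (Γ.bottomEigenvalue (Γ.ball x R)) * Γ.volume x r ≤
      ⨅ (f : V → ℝ) (_ : f.support.Finite ∧ (∀ y ∈ Γ.ball x r, f y = 1) ∧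
        ∀ y ∈ (Γ.ball x R)ᶜ, f y = 0),
        ENNReal.ofReal (Γ.innerProduct (fun y => -Γ.laplacian f y) f) := by
    refine le_iInf₂ fun f hf => ?_
    obtain ⟨-, hf1, hf0⟩ := hf
    have hf0 : ∀ y ∉ s, f y = 0 := fun y hy => hf0 y (by rwa [← hs, Set.mem_compl_iff,
      Finset.mem_coe])
    have hray := Γ.bottomEigenvalue_mul_sum_le hp hf0
    rw [hs] at hray
    rw [volume, ← ht, setMeasure_coe, ← ENNReal.ofReal_mul hpos.le]
    refine ENNReal.ofReal_le_ofReal (le_trans (mul_le_mul_of_nonneg_left ?_ hpos.le) hray)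
    refine le_trans (Finset.sum_le_sum fun z hz => ?_) (Finset.sum_le_sum_of_subset_of_nonneg hts
      fun z _ _ => mul_nonneg (sq_nonneg _) (Γ.vertexMeasure_pos z).le)
    rw [hf1 z (by rwa [← ht, Finset.mem_coe]), one_pow, one_mul]
  rw [annulusResistance, resistance, invBottomEigenvalue]
  refine (mul_le_mul_left (ENNReal.inv_le_inv.2 h) _).trans (le_of_eq ?_)
  rw [ENNReal.mul_inv (Or.inr hVt) (Or.inr hV0), mul_assoc, ENNReal.inv_mul_cancel hV0 hVt,
    mul_one]

/-- Truncating the mean exit time gives a test function for the resistance. -/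
lemma le_annulusResistance_mul_volume (Γ : WeightedGraph V) (hp : Γ.ControlledWeights) (x : V)
    {r R : ℝ} (hR : 0 < R) {a : ℝ} (ha : 0 < a)
    (hlow : ∀ z ∈ Γ.ball x r, a ≤ Γ.exitFunction (Γ.ball x R) z) :
    ENNReal.ofReal a ≤ Γ.annulusResistance x r R * Γ.volume x R := by
  obtain ⟨s, hs⟩ := Γ.exists_coe_eq_ball hp x R
  have hV0 := Γ.volume_ne_zero hp x hR
  have hVt := Γ.volume_ne_top hp x R
  -- This scaling gives `u ≥ 1` on `B(x,r)`, so `u ∧ 1` is admissible, and `-Δu = a⁻¹` on `B(x,R)`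
  -- bounds its energy by `a⁻¹V(x,R)`.
  let u : V → ℝ := fun z => a⁻¹ * Γ.exitFunction (Γ.ball x R) z
  have hu0 : ∀ z ∉ s, u z = 0 := fun z hz => by
    simp only [u]
    rw [Γ.exitFunction_of_notMem, mul_zero]
    rwa [← hs, Finset.mem_coe]
  have hm0 : ∀ z ∉ s, min (u z) 1 = 0 := fun z hz => by simp [hu0 z hz]
  have hlap : ∀ z ∈ s, -Γ.laplacian u z = a⁻¹ := by
    intro z hz
    have h := Γ.neg_laplacian_exitFunction hp (Γ.finite_ball hp x R) (z := z)
      (by rwa [← hs, Finset.mem_coe])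
    have h2 : Γ.laplacian u z = a⁻¹ * Γ.laplacian (Γ.exitFunction (Γ.ball x R)) z := by
      simp only [laplacian, u, mul_sub, ← tsum_mul_left]
      congr 1
      exact tsum_congr fun y => by ring
    rw [h2, ← mul_neg, h, mul_one]
  have hen : Γ.innerProduct (fun z => -Γ.laplacian (fun y => min (u y) 1) z)
      (fun y => min (u y) 1) ≤ a⁻¹ * ∑ z ∈ s, Γ.vertexMeasure z := by
    refine (Γ.innerProduct_laplacian_min_one_le hu0).trans ?_
    rw [Γ.innerProduct_eq_sum _ hm0, Finset.mul_sum]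
    refine Finset.sum_le_sum fun z hz =>
      mul_le_mul_of_nonneg_right ?_ (Γ.vertexMeasure_pos z).le
    rw [hlap z hz]
    exact mul_le_of_le_one_right (by positivity) (min_le_right _ _)
  have hinf : (⨅ (f : V → ℝ) (_ : f.support.Finite ∧ (∀ y ∈ Γ.ball x r, f y = 1) ∧
      ∀ y ∈ (Γ.ball x R)ᶜ, f y = 0),
      ENNReal.ofReal (Γ.innerProduct (fun y => -Γ.laplacian f y) f)) ≤
      (ENNReal.ofReal a)⁻¹ * Γ.volume x R := by
    refine (iInf₂_le (fun y => min (u y) 1) ⟨?_, ?_, ?_⟩).trans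
      ((ENNReal.ofReal_le_ofReal hen).trans (le_of_eq ?_))
    · rw [volume, ← hs, setMeasure_coe, ENNReal.ofReal_mul (by positivity),
        ENNReal.ofReal_inv_of_pos ha]
    · refine s.finite_toSet.subset fun z hz => ?_
      by_contra hcon
      exact hz (hm0 z (by simpa using hcon))
    · intro z hz
      refine min_eq_right ?_
      have := hlow z hz
      simp only [u]
      rwa [← div_eq_inv_mul, one_le_div ha]
    · intro z hz
      exact hm0 z (by rwa [← hs, Set.mem_compl_iff, Finset.mem_coe] at hz)
  rw [annulusResistance, resistance]
  refine le_trans (le_of_eq ?_) (mul_le_mul_left (ENNReal.inv_le_inv.2 hinf) _)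
  rw [ENNReal.mul_inv (Or.inr hVt) (Or.inr hV0), inv_inv, mul_assoc,
    ENNReal.inv_mul_cancel hV0 hVt, mul_one]

lemma meanExit_le_annulusResistance_mul_volume (Γ : WeightedGraph V) (hp : Γ.ControlledWeights)
    {c : ℝ≥0} (hc0 : 0 < c)
    (hc : ∀ (x : V) (R : ℝ), 0 < R → ∀ y ∈ Γ.ball x R, Γ.meanExit x (2 * R) ≤ c * Γ.meanExit y R)
    (x : V) {R : ℝ} (hR : 0 < R) :
    Γ.meanExit x (2 * R) ≤ c * (Γ.annulusResistance x R (2 * R) * Γ.volume x (2 * R)) := by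
  have h2R : 0 < 2 * R := by positivity
  have hc0' : (0 : ℝ) < c := hc0
  have hE : Γ.meanExit x (2 * R) ≠ ∞ := Γ.meanExitFrom_ne_top hp (Γ.finite_ball hp x _) x
  have he0 : 0 < (Γ.meanExit x (2 * R)).toReal :=
    Γ.exitFunction_pos hp (Γ.finite_ball hp x _) (Γ.mem_ball_self x h2R)
  have h := Γ.le_annulusResistance_mul_volume hp x (r := R) h2R
    (a := (Γ.meanExit x (2 * R)).toReal / c) (by positivity) fun z hz => by
      have h' := ENNReal.toReal_mono (ENNReal.mul_ne_top ENNReal.coe_ne_top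
        (Γ.meanExitFrom_ne_top hp (Γ.finite_ball hp x _) z))
        (Γ.meanExit_le_meanExitFrom hc hR hz)
      rw [ENNReal.toReal_mul, ENNReal.coe_toReal] at h'
      rw [div_le_iff₀ hc0', mul_comm _ (c : ℝ)]
      exact h'
  refine le_trans (le_of_eq ?_) (mul_le_mul_right h _)
  rw [← ENNReal.ofReal_coe_nnreal, ← ENNReal.ofReal_mul c.coe_nonneg,
    mul_div_cancel₀ _ hc0'.ne', ENNReal.ofReal_toReal hE]

end

end WeightedGraph

/-! ### Assembly of the comparisons -/

theorem mainTheorem1 {V : Type*} [Countable V] [Infinite V]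
    [MeasurableSpace V] [DiscreteMeasurableSpace V] (Γ : WeightedGraph V)
    (hp : Γ.ControlledWeights) (hVD : Γ.VolumeDoubling) (hTC : Γ.TimeComparison) :
    ∃ C : ℝ≥0, 1 < C ∧ ∀ (x : V) (R : ℝ), 0 < R →
      WeightedGraph.ComparableWith C (Γ.invBottomEigenvalue x (2 * R)) (Γ.meanExit x (2 * R)) ∧
      WeightedGraph.ComparableWith C (Γ.meanExit x (2 * R)) (Γ.maxMeanExit x (2 * R)) ∧
      (1 / 2 < R →
        WeightedGraph.ComparableWith C (Γ.maxMeanExit x (2 * R))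
          (Γ.annulusResistance x R (2 * R) * Γ.annulusVolume x R (2 * R)) ∧
        WeightedGraph.ComparableWith C (Γ.meanExit x (2 * R))
          (Γ.annulusResistance x R (2 * R) * Γ.annulusVolume x R (2 * R))) := by
  obtain ⟨D, -, hD⟩ := hVD
  obtain ⟨c, hc1, hc⟩ := hTC
  have hc0 : 0 < c := zero_lt_one.trans hc1
  -- The sum of the constants of all the one-sided bounds, so that it dominates each of them.
  let C : ℝ≥0 := c + c ^ 3 * D + D * c + c * D ^ 4 + c * (c * D ^ 4)
  have hcC : c ≤ C := le_add_right (le_add_right (le_add_right le_self_add))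
  have h3C : c ^ 3 * D ≤ C := le_add_right (le_add_right (le_add_right le_add_self))
  have hDcC : D * c ≤ C := le_add_right (le_add_right le_add_self)
  have h4C : c * D ^ 4 ≤ C := le_add_right le_add_self
  have h5C : c * (c * D ^ 4) ≤ C := le_add_self
  have hC1 : 1 < C := hc1.trans_le hcC
  have hC0 : 0 < C := zero_lt_one.trans hC1
  refine ⟨C, hC1, fun x R hR => ?_⟩
  have h2R : 0 < 2 * R := by positivity
  have hEm := Γ.meanExit_le_maxMeanExit x h2R
  have hmE := Γ.maxMeanExit_le hc x h2R
  have hlE := (Γ.invBottomEigenvalue_le_maxMeanExit hp x h2R).trans hmE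
  have hEl := Γ.meanExit_le_invBottomEigenvalue hp hc0 hc hD x hR
  refine ⟨.of_le hC0 hlE (k₂ := c ^ 3 * D) (by exact_mod_cast hEl) hcC h3C,
    .of_le hC0 (k₁ := 1) (by simpa using hEm) hmE hC1.le hcC, fun hR2 => ?_⟩
  set ρ := Γ.annulusResistance x R (2 * R)
  set v := Γ.annulusVolume x R (2 * R)
  have hup : ρ * v ≤ (D * c : ℝ≥0) * Γ.meanExit x (2 * R) :=
    calc ρ * v ≤ ρ * (D * Γ.volume x R) :=
          mul_le_mul_right (tsub_le_self.trans (hD x R hR)) _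
      _ = D * (ρ * Γ.volume x R) := by ring
      _ ≤ D * (c * Γ.meanExit x (2 * R)) := mul_le_mul_right
          ((Γ.annulusResistance_mul_volume_le hp x hR (by linarith)).trans hlE) _
      _ = (D * c : ℝ≥0) * Γ.meanExit x (2 * R) := by push_cast; ring
  -- Only this bound needs `R > 1/2`: for smaller `R` both balls are `{x}` and `v = 0`.
  have hlow : Γ.meanExit x (2 * R) ≤ (c * D ^ 4 : ℝ≥0) * (ρ * v) :=
    calc Γ.meanExit x (2 * R) ≤ c * (ρ * Γ.volume x (2 * R)) :=
          Γ.meanExit_le_annulusResistance_mul_volume hp hc0 hc x hR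
      _ ≤ c * (ρ * (D ^ 4 * v)) :=
          mul_le_mul_right (mul_le_mul_right (Γ.volume_le_annulusVolume hp hD x hR2) _) _
      _ = (c * D ^ 4 : ℝ≥0) * (ρ * v) := by push_cast; ring
  have hlow' : Γ.maxMeanExit x (2 * R) ≤ (c * (c * D ^ 4) : ℝ≥0) * (ρ * v) := by
    refine hmE.trans ((mul_le_mul_right hlow _).trans (le_of_eq ?_))
    push_cast
    ring
  exact ⟨.of_le hC0 hlow' (hup.trans (mul_le_mul_right hEm _)) h5C hDcC,
    .of_le hC0 hlow hup h4C hDcC⟩
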